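/- Let $S^2$ be the unit sphere in $E^3$ with the spherical distance $|ab|$ (the length of the shorter great-circle arc between $a$ and $b$). A set $C\subset S^2$ is convex if it contains no pair of antipodes and contains, with every two of its points, the shorter great-circle arc joining them; a spherical convex body is a closed convex set with non-empty interior. A hemisphere is a set $H(m)=\{x\in S^2:|mx|\le\frac{\pi}{2}\}$, $m \in S^2$; it supports a convex body $C$ if $C\subset H(m)$ and some boundary point of $C$ lies on the great circle bounding $H(m)$. If hemispheres $G,H$ are different and not opposite, then $G\cap H$ is called a lune; it is bounded by two great semicircles, and its thickness is the distance of the centers of these semicircles. For a hemisphere $K$ supporting a convex body $C$, ${\rm width}_K(C)$ is the minimum thickness of a lune $K\cap M$ over the hemispheres $M$ supporting $C$ (different from $K$ and not opposite to it). The thickness $\Delta(C)$ is the minimum of ${\rm width}_K(C)$ over all hemispheres $K$ supporting $C$. A convex body $R$ is reduced if $\Delta(Z)<\Delta(R)$ for every convex body $Z\subset R$ different from $R$, and a convex body $C$ is of constant width $w$ if ${\rm width}_K(C)=w$ for every hemisphere $K$ supporting $C$. Theorem. Every reduced spherical convex body $R\subset S^2$ such that $\Delta(R)\ge\frac{\pi}{2}$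 is of constant width $\Delta(R)$. -/

import Mathlib

/-- The unit sphere `S²` of Euclidean 3-space, as a type (with the subspace topology). -/
abbrev S2 : Type := Metric.sphere (0 : EuclideanSpace ℝ (Fin 3)) 1

namespace S2

/-- Spherical distance: the length of the shorter great-circle arc between two points, i.e. the
angle between the two unit vectors (`0` for equal points, `π` for antipodes). -/
noncomputable def sDist (a b : S2) : ℝ :=
  InnerProductGeometry.angle (a : EuclideanSpace ℝ (Fin 3)) (b : EuclideanSpace ℝ (Fin 3))

/-- The spherical arc `ab` joining two points that are not antipodes: the shorter part of the great
circle through `a` and `b`, end-points included (the single point `a` if `a = b`). -/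
def arc (a b : S2) : Set S2 :=
  {x | ∃ s t : ℝ, 0 ≤ s ∧ 0 ≤ t ∧
    (x : EuclideanSpace ℝ (Fin 3)) = s • (a : EuclideanSpace ℝ (Fin 3)) + t • (b : EuclideanSpace ℝ (Fin 3))}

/-- Spherical convexity: no pair of antipodes, and with every two points the arc joining them. -/
def IsConvex (C : Set S2) : Prop :=
  (∀ a ∈ C, -a ∉ C) ∧ ∀ a ∈ C, ∀ b ∈ C, arc a b ⊆ C

/-- A spherical convex body: a closed convex set with non-empty interior (relative to `S²`). -/
structure IsConvexBody (C : Set S2) : Prop where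
  isClosed : IsClosed C
  convex : IsConvex C
  nonempty_interior : (interior C).Nonempty

/-- The hemisphere `H(m)`, the ball of radius `π / 2` centered at `m`. A hemisphere determines its
center, so hemispheres are referred to by their centers below. -/
def hemisphere (m : S2) : Set S2 := {x | sDist m x ≤ Real.pi / 2}

/-- The great circle bounding the hemisphere `H(m)`. -/
def greatCircle (m : S2) : Set S2 := {x | sDist m x = Real.pi / 2}

/-- The hemisphere `H(m)` supports `C` at the boundary point `p`. -/
def SupportsAt (m : S2) (C : Set S2) (p : S2) : Prop :=
  p ∈ frontier C ∧ C ⊆ hemisphere m ∧ p ∈ greatCircle m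

/-- The hemisphere `H(m)` supports `C` (at some boundary point). -/
def Supports (m : S2) (C : Set S2) : Prop := ∃ p, SupportsAt m C p

/-- `H(g) ∩ H(h)` is a lune: the two hemispheres are different and not opposite. -/
def IsLune (g h : S2) : Prop := g ≠ h ∧ g ≠ -h

/-- The semicircle `G/H` for `G = H(g)`, `H = H(h)`: the part of the boundary of the lune `G ∩ H`
that lies on the great circle bounding `G`. -/
def semicircle (g h : S2) : Set S2 := greatCircle g ∩ hemisphere h

/-- `c` is the center of the semicircle `G/H`: `c` lies on the great circle bounding `G`, and `G/H`
consists of the points of that great circle in the distance at most `π / 2` from `c`. -/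
def IsSemicircleCenter (g h c : S2) : Prop :=
  c ∈ greatCircle g ∧ semicircle g h = {x ∈ greatCircle g | sDist c x ≤ Real.pi / 2}

/-- `t` is the thickness of the lune `G ∩ H`: the distance of the centers of the semicircles `G/H`
and `H/G`. -/
def IsLuneThickness (g h : S2) (t : ℝ) : Prop :=
  ∃ a b : S2, IsSemicircleCenter g h a ∧ IsSemicircleCenter h g b ∧ t = sDist a b

/-- The thicknesses of all lunes `K ∩ M`, where `K = H(k)` is fixed and `M` runs over the
hemispheres supporting `C`. -/
def luneThicknesses (C : Set S2) (k : S2) : Set ℝ :=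
  {t | ∃ m : S2, Supports m C ∧ IsLune k m ∧ IsLuneThickness k m t}

/-- The width of `C` determined by the supporting hemisphere `K = H(k)`: the minimum thickness of a
lune `K ∩ M` with `M` supporting `C`. -/
noncomputable def width (C : Set S2) (k : S2) : ℝ := sInf (luneThicknesses C k)

/-- The thickness `Δ(C)`: the minimum width of `C` over all hemispheres supporting `C`. -/
noncomputable def thickness (C : Set S2) : ℝ := sInf {w | ∃ k : S2, Supports k C ∧ w = width C k}

/-- `R` is a reduced spherical convex body: every convex body properly contained in `R` has smaller
thickness. -/
def IsReduced (R : Set S2) : Prop :=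
  IsConvexBody R ∧ ∀ Z : Set S2, IsConvexBody Z → Z ⊆ R → Z ≠ R → thickness Z < thickness R

/-- `C` is a spherical convex body of constant width `w`. -/
def IsConstantWidth (C : Set S2) (w : ℝ) : Prop :=
  IsConvexBody C ∧ ∀ k : S2, Supports k C → width C k = w

section Lune

local notation "E3" => EuclideanSpace ℝ (Fin 3)

theorem norm_coe (a : S2) : ‖(a : E3)‖ = 1 := by simp

theorem inner_coe_self (a : S2) : inner ℝ (a : E3) (a : E3) = 1 := by
  rw [real_inner_self_eq_norm_sq, norm_coe]; norm_num

theorem sDist_eq (a b : S2) : sDist a b = Real.arccos (inner ℝ (a : E3) (b : E3)) := by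
  simp [sDist, InnerProductGeometry.angle]

theorem sDist_le_iff (a b : S2) : sDist a b ≤ Real.pi / 2 ↔ 0 ≤ inner ℝ (a : E3) (b : E3) := by
  rw [sDist_eq, Real.arccos_le_pi_div_two]

theorem sDist_eq_iff (a b : S2) : sDist a b = Real.pi / 2 ↔ inner ℝ (a : E3) (b : E3) = 0 := by
  rw [sDist_eq, Real.arccos_eq_pi_div_two]

theorem isSemicircleCenter_iff (g h c : S2) : IsSemicircleCenter g h c ↔
    inner ℝ (g : E3) (c : E3) = 0 ∧ ∀ x : S2, inner ℝ (g : E3) (x : E3) = 0 →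
      (0 ≤ inner ℝ (h : E3) (x : E3) ↔ 0 ≤ inner ℝ (c : E3) (x : E3)) := by
  simp only [IsSemicircleCenter, semicircle, greatCircle, hemisphere, sDist_le_iff, sDist_eq_iff,
    Set.ext_iff, Set.mem_inter_iff, Set.mem_ofPred_eq]
  refine and_congr Iff.rfl (forall_congr' fun x => ?_)
  tauto

theorem inner_sq_lt_one {g h : S2} (L : IsLune g h) : (inner ℝ (g : E3) (h : E3)) ^ 2 < 1 := by
  have h1 : inner ℝ (g : E3) (h : E3) ≠ 1 := fun e =>
    L.1 (Subtype.ext ((inner_eq_one_iff_of_norm_eq_one (norm_coe g) (norm_coe h)).1 e))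
  have h2 : inner ℝ (g : E3) (h : E3) ≠ -1 := fun e => by
    refine L.2 (Subtype.ext ?_)
    have h3 : inner ℝ (g : E3) ((-h : S2) : E3) = 1 := by simp [e]
    exact (inner_eq_one_iff_of_norm_eq_one (norm_coe g) (norm_coe _)).1 h3
  have h3 := abs_real_inner_le_norm (g : E3) (h : E3)
  rw [norm_coe, norm_coe, mul_one, abs_le] at h3
  have h4 := lt_of_le_of_ne h3.2 h1
  have h5 := lt_of_le_of_ne h3.1 (Ne.symm h2)
  nlinarith

theorem isSemicircleCenter_of_eq_smul {g h c : S2} {r : ℝ} (hr : 0 < r)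
    (hc : (c : E3) = r • ((h : E3) - (inner ℝ (g : E3) (h : E3)) • (g : E3))) :
    IsSemicircleCenter g h c := by
  rw [isSemicircleCenter_iff, hc]
  refine ⟨?_, fun x hx => ?_⟩
  · rw [inner_smul_right, inner_sub_right, inner_smul_right, inner_coe_self]; ring
  · rw [real_inner_smul_left, inner_sub_left, real_inner_smul_left, hx, mul_zero, sub_zero]
    exact (mul_nonneg_iff_of_pos_left hr).symm

theorem exists_eq_smul {g h : S2} (L : IsLune g h) : ∃ (c : S2) (r : ℝ), 0 < r ∧
    r ^ 2 * (1 - (inner ℝ (g : E3) (h : E3)) ^ 2) = 1 ∧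
    (c : E3) = r • ((h : E3) - (inner ℝ (g : E3) (h : E3)) • (g : E3)) := by
  have h1 := inner_sq_lt_one L
  set k := inner ℝ (g : E3) (h : E3) with hk
  have h2 : ‖(h : E3) - k • (g : E3)‖ ^ 2 = 1 - k ^ 2 := by
    rw [norm_sub_sq_real, inner_smul_right, real_inner_comm, ← hk, norm_smul, norm_coe, norm_coe,
      Real.norm_eq_abs, mul_one, sq_abs]
    ring
  have h3 : 0 < ‖(h : E3) - k • (g : E3)‖ := by
    refine lt_of_le_of_ne (norm_nonneg _) fun e => ?_
    rw [← e] at h2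
    nlinarith
  refine ⟨⟨‖(h : E3) - k • (g : E3)‖⁻¹ • ((h : E3) - k • (g : E3)), ?_⟩,
    ‖(h : E3) - k • (g : E3)‖⁻¹, inv_pos.2 h3, ?_, rfl⟩
  · rw [mem_sphere_zero_iff_norm, norm_smul, norm_inv, norm_norm, inv_mul_cancel₀ h3.ne']
  · rw [← h2, inv_pow, inv_mul_cancel₀ (pow_ne_zero 2 h3.ne')]

/-- A semicircle has at most one center. -/
theorem isSemicircleCenter_unique {g h a b : S2} (ha : IsSemicircleCenter g h a)
    (hb : IsSemicircleCenter g h b) : a = b := by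
  rw [isSemicircleCenter_iff] at ha hb
  have key : ∀ x : S2, inner ℝ (g : E3) (x : E3) = 0 →
      (0 ≤ inner ℝ (a : E3) (x : E3) ↔ 0 ≤ inner ℝ (b : E3) (x : E3)) := fun x hx =>
    (ha.2 x hx).symm.trans (hb.2 x hx)
  by_contra hne
  by_cases hop : a = -b
  · have h1 := (key a ha.1).1 (by rw [inner_coe_self]; norm_num)
    rw [hop] at h1
    have h2 : inner ℝ (b : E3) ((-b : S2) : E3) = -1 := by
      simp
    rw [h2] at h1
    norm_num at h1
  · have L : IsLune a b := ⟨hne, hop⟩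
    obtain ⟨c, r, hr, hr2, hc⟩ := exists_eq_smul L
    have h1 : inner ℝ (a : E3) (c : E3) = 0 := by
      rw [hc, inner_smul_right, inner_sub_right, inner_smul_right, inner_coe_self]; ring
    have h2 : inner ℝ (g : E3) (c : E3) = 0 := by
      rw [hc, inner_smul_right, inner_sub_right, inner_smul_right, ha.1, hb.1]; ring
    have h3 : inner ℝ (b : E3) (c : E3) = r * (1 - (inner ℝ (a : E3) (b : E3)) ^ 2) := by
      rw [hc, inner_smul_right, inner_sub_right, inner_smul_right, inner_coe_self,
        real_inner_comm]
      ring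
    have h4 := (key (-c) (by simp [h2])).1 (by simp [h1])
    have h5 : inner ℝ (b : E3) ((-c : S2) : E3) = -(r * (1 - (inner ℝ (a : E3) (b : E3)) ^ 2)) := by
      simp [← h3]
    rw [h5] at h4
    have := mul_pos hr (sub_pos.2 (inner_sq_lt_one L))
    linarith

/-- A lune `H(g) ∩ H(h)` has exactly one thickness, the angle supplementary to that of `g, h`. -/
theorem isLuneThickness_iff {g h : S2} (L : IsLune g h) (t : ℝ) :
    IsLuneThickness g h t ↔ t = Real.pi - sDist g h := by
  have L' : IsLune h g := ⟨L.1.symm, fun e => L.2 (by rw [e, neg_neg])⟩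
  obtain ⟨a, r, hr, hr2, ha⟩ := exists_eq_smul L
  obtain ⟨b, s, hs, hs2, hb⟩ := exists_eq_smul L'
  have ha' := isSemicircleCenter_of_eq_smul hr ha
  have hb' := isSemicircleCenter_of_eq_smul hs hb
  have hab : sDist a b = Real.pi - sDist g h := by
    have hsym : inner ℝ (h : E3) (g : E3) = inner ℝ (g : E3) (h : E3) := real_inner_comm _ _
    have hlt := inner_sq_lt_one L
    rw [hsym] at hs2 hb
    have hrs : r = s := by
      have h0 : (1 - (inner ℝ (g : E3) (h : E3)) ^ 2) ≠ 0 := (sub_pos.2 hlt).ne'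
      have h1 : r ^ 2 = s ^ 2 := mul_right_cancel₀ h0 (hr2.trans hs2.symm)
      exact (pow_left_inj₀ hr.le hs.le two_ne_zero).1 h1
    rw [sDist_eq, sDist_eq, ← Real.arccos_neg, ha, hb, ← hrs]
    congr 1
    simp only [inner_smul_left, inner_smul_right, inner_sub_left, inner_sub_right, inner_coe_self,
      hsym, conj_trivial]
    linear_combination (-(inner ℝ (g : E3) (h : E3))) * hr2
  constructor
  · rintro ⟨a', b', h1, h2, rfl⟩
    rw [isSemicircleCenter_unique h1 ha', isSemicircleCenter_unique h2 hb', hab]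
  · rintro rfl
    exact ⟨a, b, ha', hb', hab.symm⟩

end Lune

end S2

/-!
The polar cone `C* = {u | ⟪x, u⟫ ≥ 0 for all x ∈ C}` turns the theorem into a statement about
diameters. The centers of the hemispheres supporting `C` are the unit vectors on the boundary of
`C*`, and the lune of two supporting hemispheres with centers `k` and `m` has thickness
`π - |km|`. So `Δ(C) = π - δ`, where `δ` is the angular diameter of `C*`, and a reduced body is one
whose polar cone cannot be enlarged without an increase of the diameter.

Let `Δ(R) ≥ π / 2`, so that `c = cos δ ≥ 0`. Then the circular cones `{u | c‖u‖‖v‖ ≤ ⟪u, v⟫}`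
(`capCone`) are convex. If `width_K(R) > Δ(R)` for a supporting hemisphere `K = H(k)` touching `R`
at `p`, then the points of `R*` are at angular distance less than `δ` from `k`, uniformly
(`inner_ge_of_lune_bound`), so that `q = k - εp`, with small `ε > 0`, is at distance at most `δ`
from `R*` although `q ∉ R*`. The set `Z = {x ∈ R | ⟪q, x⟫ ≥ 0}` is a convex body properly contained
in `R`. A closed convex cone containing `R*` and `q` contains `Z*`
(`polar_inter_halfspace_le`, by separation); applied to the circular cones this shows that the
diameter of `Z*` is still at most `δ`. Hence `Δ(Z) ≥ Δ(R)`, and `R` is not reduced.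
-/

namespace S2

local notation "E3" => EuclideanSpace ℝ (Fin 3)

theorem hemisphere_iff (m x : S2) : x ∈ hemisphere m ↔ 0 ≤ inner ℝ (x : E3) (m : E3) := by
  rw [real_inner_comm]
  exact sDist_le_iff m x

theorem greatCircle_iff (m x : S2) : x ∈ greatCircle m ↔ inner ℝ (x : E3) (m : E3) = 0 := by
  rw [real_inner_comm]
  exact sDist_eq_iff m x

theorem exists_smul_coe {v : E3} (hv : v ≠ 0) : ∃ a : S2, v = ‖v‖ • (a : E3) := by
  have h : ‖v‖ ≠ 0 := norm_ne_zero_iff.2 hv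
  refine ⟨⟨‖v‖⁻¹ • v, ?_⟩, ?_⟩
  · rw [mem_sphere_zero_iff_norm, norm_smul, norm_inv, norm_norm, inv_mul_cancel₀ h]
  · rw [smul_inv_smul₀ h]

/-- The cone of the vectors that have nonnegative inner product with all points of `C`; its unit
vectors are the centers of the hemispheres containing `C`. -/
noncomputable def polar (C : Set S2) : ProperCone ℝ E3 :=
  ProperCone.innerDual ((fun x : S2 => (x : E3)) '' C)

theorem mem_polar {C : Set S2} {u : E3} : u ∈ polar C ↔ ∀ x ∈ C, 0 ≤ inner ℝ (x : E3) u := by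
  simp only [polar, ProperCone.mem_innerDual, Set.forall_mem_image]

theorem Supports.mem_polar {C : Set S2} {m : S2} (h : Supports m C) : (m : E3) ∈ polar C := by
  obtain ⟨p, -, h, -⟩ := h
  exact S2.mem_polar.2 fun x hx => (hemisphere_iff m x).1 (h hx)

/-! ### Separation -/

/-- The cone generated by a nonempty closed convex subset of the sphere. -/
def coneOver (C : Set S2) (hcl : IsClosed C) (hne : C.Nonempty) (hC : IsConvex C) :
    ProperCone ℝ E3 where
  carrier := {v | ∃ x ∈ C, v = ‖v‖ • (x : E3)}
  zero_mem' := by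
    obtain ⟨x, hx⟩ := hne
    exact ⟨x, hx, by simp⟩
  add_mem' := by
    rintro a b ⟨x, hx, ha⟩ ⟨y, hy, hb⟩
    by_cases h : a + b = 0
    · exact ⟨x, hx, by simp [h]⟩
    · obtain ⟨z, hz⟩ := exists_smul_coe h
      refine ⟨z, hC.2 x hx y hy ⟨‖a + b‖⁻¹ * ‖a‖, ‖a + b‖⁻¹ * ‖b‖, by positivity, by positivity, ?_⟩,
        hz⟩
      rw [mul_smul, mul_smul, ← ha, ← hb, ← smul_add]
      rw [eq_inv_smul_iff₀ (norm_ne_zero_iff.2 h), ← hz]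
  smul_mem' := by
    rintro ⟨r, hr⟩ v ⟨x, hx, hv⟩
    refine ⟨x, hx, ?_⟩
    change r • v = ‖r • v‖ • (x : E3)
    rw [norm_smul, Real.norm_of_nonneg hr, mul_smul, ← hv]
  isClosed' := by
    have h : IsClosed {z : S2 × E3 | z.1 ∈ C ∧ z.2 = ‖z.2‖ • (z.1 : E3)} :=
      (hcl.preimage continuous_fst).inter (isClosed_eq (by fun_prop) (by fun_prop))
    convert isClosedMap_snd_of_compactSpace _ h using 1
    ext v
    constructor
    · rintro ⟨x, hx, hv⟩
      exact ⟨(x, v), ⟨hx, hv⟩, rfl⟩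
    · rintro ⟨⟨x, w⟩, ⟨hx, hv⟩, rfl⟩
      exact ⟨x, hx, hv⟩

/-- The bipolar theorem: a convex body is the intersection of the hemispheres containing it. -/
theorem mem_of_forall_mem_polar {C : Set S2} (hC : IsConvexBody C) {x : S2}
    (h : ∀ u ∈ polar C, 0 ≤ inner ℝ (x : E3) u) : x ∈ C := by
  by_contra hx
  have hne := hC.nonempty_interior.mono interior_subset
  have hx' : (x : E3) ∉ coneOver C hC.isClosed hne hC.convex := by
    rintro ⟨y, hy, e⟩
    rw [norm_coe, one_smul] at e
    exact hx (Subtype.ext e ▸ hy)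
  obtain ⟨y, hy, hxy⟩ := ProperCone.hyperplane_separation' _ hx'
  refine hxy.not_ge (h y (mem_polar.2 fun z hz => hy z ⟨z, hz, ?_⟩))
  rw [norm_coe, one_smul]

/-- The polar of the part of `C` in a half-space `{x | ⟪q, x⟫ ≥ 0}` is contained in every closed
convex cone that contains `q` and the polar of `C`. -/
theorem polar_inter_halfspace_le {C : Set S2} (hC : IsConvexBody C) {q : E3} {B : ProperCone ℝ E3}
    (hB : ∀ u ∈ polar C, u ∈ B) (hq : q ∈ B) {m : E3}
    (hm : m ∈ polar {x ∈ C | 0 ≤ inner ℝ q (x : E3)}) : m ∈ B := by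
  by_contra h
  obtain ⟨y, hy, hmy⟩ := ProperCone.hyperplane_separation' _ h
  have hy0 : y ≠ 0 := by
    rintro rfl
    simp at hmy
  obtain ⟨z, hz⟩ := exists_smul_coe hy0
  have hpos : 0 < ‖y‖ := norm_pos_iff.2 hy0
  have key : ∀ u : E3, 0 ≤ inner ℝ u y ↔ 0 ≤ inner ℝ u (z : E3) := fun u => by
    rw [hz, inner_smul_right]
    exact mul_nonneg_iff_of_pos_left hpos
  have hzC : z ∈ C := mem_of_forall_mem_polar hC fun u hu => by
    rw [real_inner_comm]
    exact (key u).1 (hy u (hB u hu))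
  refine hmy.not_ge ((key m).2 ?_)
  rw [real_inner_comm]
  exact mem_polar.1 hm z ⟨hzC, (key q).1 (hy q hq)⟩

/-! ### Supporting hemispheres and the boundary of the polar cone -/

theorem inner_pos_of_mem_interior {C : Set S2} {n : E3} (hn : n ∈ polar C) (hn0 : n ≠ 0) {p : S2}
    (hp : p ∈ interior C) : 0 < inner ℝ (p : E3) n := by
  have hn' := mem_polar.1 hn
  refine lt_of_le_of_ne (hn' p (interior_subset hp)) fun h0 => ?_
  -- Otherwise moving `p` slightly in the direction of `-n` stays in `C` and leaves the half-space.
  have hnpos : 0 < ‖n‖ := norm_pos_iff.2 hn0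
  have hv : ∀ t : ℝ, (p : E3) - t • n ≠ 0 := fun t h => by
    have h1 : inner ℝ (p : E3) ((p : E3) - t • n) = 1 := by
      rw [inner_sub_right, inner_smul_right, inner_coe_self, ← h0]; ring
    rw [h, inner_zero_right] at h1
    norm_num at h1
  let f : ℝ → S2 := fun t => ⟨‖(p : E3) - t • n‖⁻¹ • ((p : E3) - t • n), by
    rw [mem_sphere_zero_iff_norm, norm_smul, norm_inv, norm_norm,
      inv_mul_cancel₀ (norm_ne_zero_iff.2 (hv t))]⟩
  have hf : Continuous f := by
    have hg : Continuous fun t : ℝ => (p : E3) - t • n := by fun_prop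
    exact ((hg.norm.inv₀ fun t => norm_ne_zero_iff.2 (hv t)).smul hg).subtype_mk _
  have hf0 : f 0 = p := Subtype.ext (by simp [f])
  have hU : f ⁻¹' interior C ∈ nhds (0 : ℝ) :=
    (isOpen_interior.preimage hf).mem_nhds (by rw [Set.mem_preimage, hf0]; exact hp)
  obtain ⟨ε, hε, hball⟩ := Metric.mem_nhds_iff.1 hU
  have ht : f (ε / 2) ∈ interior C := hball (by
    rw [Metric.mem_ball, dist_zero_right, Real.norm_of_nonneg (by positivity)]; linarith)
  have h1 := hn' _ (interior_subset ht)
  have h2 : inner ℝ ((f (ε / 2) : S2) : E3) n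
      = ‖(p : E3) - (ε / 2) • n‖⁻¹ * -(ε / 2 * ‖n‖ ^ 2) := by
    simp only [f]
    rw [real_inner_smul_left, inner_sub_left, real_inner_smul_left, ← h0,
      real_inner_self_eq_norm_sq]
    ring
  have h3 : 0 < ‖(p : E3) - (ε / 2) • n‖⁻¹ := inv_pos.2 (norm_pos_iff.2 (hv _))
  have h4 : 0 < ε / 2 * ‖n‖ ^ 2 := by positivity
  rw [h2] at h1
  nlinarith [mul_pos h3 h4]

theorem supports_of_inner_eq_zero {C : Set S2} {a p : S2} (ha : (a : E3) ∈ polar C) (hp : p ∈ C)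
    (h0 : inner ℝ (p : E3) (a : E3) = 0) : Supports a C := by
  refine ⟨p, ⟨subset_closure hp, fun hi => ?_⟩,
    fun x hx => (hemisphere_iff a x).2 (mem_polar.1 ha x hx), (greatCircle_iff a p).2 h0⟩
  exact (inner_pos_of_mem_interior ha (ne_zero_of_mem_unit_sphere a) hi).ne' h0

/-- From a vector of the polar cone, a largest multiple of a unit vector `k` of the cone can be
subtracted; what remains is orthogonal to some point of `C`. -/
theorem exists_sub_smul_mem_polar {C : Set S2} (hC : IsConvexBody C) {k : S2} {u : E3}
    (hk : (k : E3) ∈ polar C) (hu : u ∈ polar C) :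
    ∃ s : ℝ, 0 ≤ s ∧ u - s • (k : E3) ∈ polar C ∧
      ∃ p ∈ C, inner ℝ (p : E3) (u - s • (k : E3)) = 0 := by
  obtain ⟨x, hx⟩ := hC.nonempty_interior
  have hxk := inner_pos_of_mem_interior hk (ne_zero_of_mem_unit_sphere k) hx
  let T : Set ℝ := {s | 0 ≤ s ∧ u - s • (k : E3) ∈ polar C}
  have hTcl : IsClosed T :=
    isClosed_Ici.inter ((polar C).isClosed.preimage (by fun_prop :
      Continuous fun s : ℝ => u - s • (k : E3)))
  have hT0 : (0 : ℝ) ∈ T := ⟨le_rfl, by simpa using hu⟩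
  have hTb : BddAbove T := by
    refine ⟨inner ℝ (x : E3) u / inner ℝ (x : E3) (k : E3), fun s hs => ?_⟩
    have h := mem_polar.1 hs.2 x (interior_subset hx)
    rw [inner_sub_right, inner_smul_right] at h
    rw [le_div_iff₀ hxk]
    linarith
  have hs := hTcl.csSup_mem ⟨0, hT0⟩ hTb
  set s := sSup T with hsdef
  refine ⟨s, hs.1, hs.2, ?_⟩
  by_contra! hno
  obtain ⟨p, hp, hmin⟩ := hC.isClosed.isCompact.exists_isMinOn ⟨x, interior_subset hx⟩
    (by fun_prop : Continuous fun y : S2 => inner ℝ (y : E3) (u - s • (k : E3))).continuousOn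
  have hδ := lt_of_le_of_ne (mem_polar.1 hs.2 p hp) (hno p hp).symm
  set δ := inner ℝ (p : E3) (u - s • (k : E3)) with hδdef
  have hmem : s + δ ∈ T := by
    refine ⟨by linarith [hs.1], mem_polar.2 fun y hy => ?_⟩
    have h1 : δ ≤ inner ℝ (y : E3) (u - s • (k : E3)) := hmin hy
    have h2 := real_inner_le_norm (y : E3) (k : E3)
    rw [norm_coe, norm_coe, mul_one] at h2
    rw [add_smul, ← sub_sub, inner_sub_right, inner_smul_right]
    nlinarith
  linarith [le_csSup hTb hmem]

/-- A vector of the polar cone not proportional to `k` yields a supporting hemisphere that forms a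
lune with `H(k)`. -/
theorem exists_supports_isLune {C : Set S2} (hC : IsConvexBody C) {k : S2} {u : E3}
    (hk : (k : E3) ∈ polar C) (hu : u ∈ polar C) (hne : ∀ r : ℝ, u ≠ r • (k : E3)) :
    ∃ m : S2, Supports m C ∧ IsLune k m := by
  obtain ⟨s, -, hn, p, hp, h0⟩ := exists_sub_smul_mem_polar hC hk hu
  have hn0 : u - s • (k : E3) ≠ 0 := sub_ne_zero.2 (hne s)
  have hpos := norm_pos_iff.2 hn0
  obtain ⟨m, hm⟩ := exists_smul_coe hn0
  have hmn : (m : E3) = ‖u - s • (k : E3)‖⁻¹ • (u - s • (k : E3)) := by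
    rw [eq_inv_smul_iff₀ hpos.ne', ← hm]
  have hnm : ∀ r : ℝ, (m : E3) ≠ r • (k : E3) := fun r hr => by
    rw [hr, sub_eq_iff_eq_add, smul_smul, ← add_smul] at hm
    exact hne _ hm
  refine ⟨m, supports_of_inner_eq_zero ?_ hp ?_, ?_, ?_⟩
  · rw [hmn]
    exact (polar C).smul_mem hn (inv_nonneg.2 hpos.le)
  · rw [hmn, inner_smul_right, h0, mul_zero]
  · rintro rfl
    exact hnm 1 (by rw [one_smul])
  · rintro rfl
    exact hnm (-1) (by simp)

/-! ### Lower bounds for inner products on the polar cone -/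

/-- The circular cone of the vectors whose angle with `v` has cosine at least `c`. -/
def capCone (c : ℝ) (hc : 0 ≤ c) (v : E3) : ProperCone ℝ E3 where
  carrier := {u | c * ‖u‖ * ‖v‖ ≤ inner ℝ u v}
  zero_mem' := by simp
  add_mem' := by
    intro a b ha hb
    have h := mul_le_mul_of_nonneg_right (mul_le_mul_of_nonneg_left (norm_add_le a b) hc)
      (norm_nonneg v)
    simp only [Set.mem_ofPred_eq] at ha hb ⊢
    rw [inner_add_left]
    linarith
  smul_mem' := by
    rintro ⟨r, hr⟩ u hu
    simp only [Set.mem_ofPred_eq] at hu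
    change c * ‖r • u‖ * ‖v‖ ≤ inner ℝ (r • u) v
    rw [norm_smul, Real.norm_of_nonneg hr, real_inner_smul_left]
    linarith [mul_le_mul_of_nonneg_left hu hr]
  isClosed' := isClosed_le (by fun_prop) (by fun_prop)

theorem mem_capCone {c : ℝ} {hc : 0 ≤ c} {u v : E3} :
    u ∈ capCone c hc v ↔ c * ‖u‖ * ‖v‖ ≤ inner ℝ u v := Iff.rfl

theorem mem_capCone_comm {c : ℝ} {hc : 0 ≤ c} {u v : E3} :
    u ∈ capCone c hc v ↔ v ∈ capCone c hc u := by
  rw [mem_capCone, mem_capCone, real_inner_comm, mul_right_comm]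

theorem self_mem_capCone {c : ℝ} {hc : 0 ≤ c} (hc1 : c ≤ 1) (v : E3) : v ∈ capCone c hc v := by
  rw [mem_capCone, real_inner_self_eq_norm_sq]
  nlinarith [sq_nonneg ‖v‖]

/-- A closed convex cone that contains `k` and the centers of all supporting hemispheres forming a
lune with `H(k)` contains the polar cone. -/
theorem polar_le_of_supports {C : Set S2} (hC : IsConvexBody C) {k : S2} (hk : (k : E3) ∈ polar C)
    {B : ProperCone ℝ E3} (hkB : (k : E3) ∈ B)
    (hB : ∀ m : S2, Supports m C → IsLune k m → (m : E3) ∈ B) {u : E3} (hu : u ∈ polar C) :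
    u ∈ B := by
  obtain ⟨s, hs, hn, p, hp, h0⟩ := exists_sub_smul_mem_polar hC hk hu
  have hsk : s • (k : E3) ∈ B := B.smul_mem hkB hs
  rw [← sub_add_cancel u (s • (k : E3))]
  refine B.add_mem ?_ hsk
  by_cases hn0 : u - s • (k : E3) = 0
  · rw [hn0]
    exact B.zero_mem
  have hpos := norm_pos_iff.2 hn0
  obtain ⟨m, hm⟩ := exists_smul_coe hn0
  have hmn : (m : E3) = ‖u - s • (k : E3)‖⁻¹ • (u - s • (k : E3)) := by
    rw [eq_inv_smul_iff₀ hpos.ne', ← hm]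
  have hmC : (m : E3) ∈ polar C := by
    rw [hmn]
    exact (polar C).smul_mem hn (inv_nonneg.2 hpos.le)
  rw [hm]
  refine B.smul_mem ?_ hpos.le
  by_cases hkm : k = m
  · rwa [← hkm]
  refine hB m (supports_of_inner_eq_zero hmC hp ?_) ⟨hkm, fun e => ?_⟩
  · rw [hmn, inner_smul_right, h0, mul_zero]
  · obtain ⟨x, hx⟩ := hC.nonempty_interior
    have h1 := inner_pos_of_mem_interior hk (ne_zero_of_mem_unit_sphere k) hx
    have h2 := mem_polar.1 hmC x (interior_subset hx)
    have h3 : inner ℝ (x : E3) (k : E3) = -inner ℝ (x : E3) (m : E3) := by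
      rw [e]; simp
    linarith

/-- A lower bound for the cosine of the distance of `k` to the centers of the other supporting
hemispheres is valid on all of the polar cone. -/
theorem inner_ge_of_lune_bound {C : Set S2} (hC : IsConvexBody C) {k : S2} (hk : (k : E3) ∈ polar C)
    {c : ℝ} (hc : 0 ≤ c) (hc1 : c ≤ 1)
    (h : ∀ m : S2, Supports m C → IsLune k m → c ≤ inner ℝ (k : E3) (m : E3)) {u : E3}
    (hu : u ∈ polar C) : u ∈ capCone c hc (k : E3) := by
  refine polar_le_of_supports hC hk (self_mem_capCone hc1 _) (fun m hm hl => ?_) hu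
  rw [mem_capCone, norm_coe, norm_coe, mul_one, mul_one, real_inner_comm]
  exact h m hm hl

/-! ### Width and thickness -/

theorem nonneg_of_mem_luneThicknesses {C : Set S2} {k : S2} {t : ℝ}
    (ht : t ∈ luneThicknesses C k) : 0 ≤ t := by
  obtain ⟨m, -, hl, h⟩ := ht
  rw [(isLuneThickness_iff hl t).1 h]
  exact sub_nonneg.2 (InnerProductGeometry.angle_le_pi _ _)

theorem width_nonneg (C : Set S2) (k : S2) : 0 ≤ width C k :=
  Real.sInf_nonneg fun _ => nonneg_of_mem_luneThicknesses

theorem width_le {C : Set S2} {k m : S2} (hm : Supports m C) (hl : IsLune k m) :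
    width C k ≤ Real.pi - sDist k m :=
  csInf_le ⟨0, fun _ => nonneg_of_mem_luneThicknesses⟩
    ⟨m, hm, hl, (isLuneThickness_iff hl _).2 rfl⟩

theorem width_le_pi (C : Set S2) (k : S2) : width C k ≤ Real.pi := by
  rcases (luneThicknesses C k).eq_empty_or_nonempty with h | ⟨t, m, hm, hl, -⟩
  · rw [width, h, Real.sInf_empty]
    exact Real.pi_pos.le
  · exact (width_le hm hl).trans (sub_le_self _ (InnerProductGeometry.angle_nonneg _ _))

theorem thickness_le_width {C : Set S2} {k : S2} (hk : Supports k C) :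
    thickness C ≤ width C k := by
  refine csInf_le ⟨0, ?_⟩ ⟨k, hk, rfl⟩
  rintro w ⟨k, -, rfl⟩
  exact width_nonneg C k

theorem neg_cos_le_inner {k m : S2} {w : ℝ} (hw0 : 0 ≤ w) (hw : w ≤ Real.pi - sDist k m) :
    -Real.cos w ≤ inner ℝ (k : E3) (m : E3) := by
  have h := Real.cos_le_cos_of_nonneg_of_le_pi (InnerProductGeometry.angle_nonneg (k : E3) (m : E3))
    (by linarith : Real.pi - w ≤ Real.pi) (show sDist k m ≤ Real.pi - w by linarith)
  rw [Real.cos_pi_sub, ← sDist, sDist_eq, Real.cos_arccos] at h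
  · exact h
  · have := (abs_le.1 (abs_real_inner_le_norm (k : E3) (m : E3))).1
    simpa using this
  · have := (abs_le.1 (abs_real_inner_le_norm (k : E3) (m : E3))).2
    simpa using this

theorem le_pi_sub_sDist {k m : S2} {w : ℝ} (hw0 : 0 ≤ w) (hw : w ≤ Real.pi)
    (h : -Real.cos w ≤ inner ℝ (k : E3) (m : E3)) : w ≤ Real.pi - sDist k m := by
  have h1 := Real.arccos_le_arccos h
  rw [← sDist_eq, Real.arccos_neg, Real.arccos_cos hw0 hw] at h1
  linarith

/-- The polar cone of a body of thickness `w` has angular diameter at most `π - w`. -/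
theorem mem_capCone_of_le_thickness {C : Set S2} (hC : IsConvexBody C) (hne : ∃ k, Supports k C)
    {w : ℝ} (hw0 : 0 ≤ w) (hw : w ≤ thickness C) (hc : 0 ≤ -Real.cos w) {u v : E3}
    (hu : u ∈ polar C) (hv : v ∈ polar C) : u ∈ capCone (-Real.cos w) hc v := by
  have hc1 : -Real.cos w ≤ 1 := by linarith [Real.neg_one_le_cos w]
  have hsupp : ∀ k : S2, Supports k C → ∀ {u : E3}, u ∈ polar C →
      u ∈ capCone (-Real.cos w) hc (k : E3) := fun k hk u hu =>
    inner_ge_of_lune_bound hC hk.mem_polar hc hc1 (fun m hm hl =>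
      neg_cos_le_inner hw0 ((hw.trans (thickness_le_width hk)).trans (width_le hm hl))) hu
  obtain ⟨k, hk⟩ := hne
  exact polar_le_of_supports hC hk.mem_polar (mem_capCone_comm.1 (hsupp k hk hv))
    (fun m hm _ => mem_capCone_comm.1 (hsupp m hm hv)) hu

/-- Conversely, a bound for the angular diameter of the polar cone bounds the thickness. The two
independent vectors provide supporting hemispheres that form lunes, so that the infima defining the
thickness are not taken over empty sets. -/
theorem le_thickness_of_mem_capCone {C : Set S2} (hC : IsConvexBody C) {w : ℝ} (hw0 : 0 ≤ w)
    (hw : w ≤ Real.pi) {hc : 0 ≤ -Real.cos w}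
    (h : ∀ u ∈ polar C, ∀ v ∈ polar C, u ∈ capCone (-Real.cos w) hc v) {a b : E3}
    (ha : a ∈ polar C) (hb : b ∈ polar C) (hab : LinearIndependent ℝ ![a, b]) :
    w ≤ thickness C := by
  have hex : ∀ k : S2, (k : E3) ∈ polar C → ∃ m : S2, Supports m C ∧ IsLune k m := fun k hk => by
    by_cases hr : ∃ r : ℝ, a = r • (k : E3)
    · obtain ⟨r, rfl⟩ := hr
      refine exists_supports_isLune hC hk hb fun s e => ?_
      rw [LinearIndependent.pair_iff] at hab
      have h1 := hab s (-r) (by rw [e, smul_smul, smul_smul, ← add_smul]; simp [mul_comm])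
      have h2 := hab 0 1 (by simp [e, h1.1])
      exact one_ne_zero h2.2
    · push Not at hr
      exact exists_supports_isLune hC hk ha hr
  have ha0 : a ≠ 0 := hab.ne_zero 0
  obtain ⟨k₀, hk₀⟩ := exists_smul_coe ha0
  have hk₀C : (k₀ : E3) ∈ polar C := by
    have h1 : (k₀ : E3) = ‖a‖⁻¹ • a := by
      rw [eq_inv_smul_iff₀ (norm_ne_zero_iff.2 ha0), ← hk₀]
    rw [h1]
    exact (polar C).smul_mem ha (by positivity)
  obtain ⟨k₁, hk₁, -⟩ := hex k₀ hk₀C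
  refine le_csInf ⟨_, k₁, hk₁, rfl⟩ ?_
  rintro _ ⟨k, hk, rfl⟩
  obtain ⟨m, hm, hl⟩ := hex k hk.mem_polar
  refine le_csInf ⟨_, m, hm, hl, (isLuneThickness_iff hl _).2 rfl⟩ ?_
  rintro t ⟨m, hm, hl, ht⟩
  rw [(isLuneThickness_iff hl t).1 ht]
  refine le_pi_sub_sDist hw0 hw ?_
  have h1 := h _ hk.mem_polar _ hm.mem_polar
  rwa [mem_capCone, norm_coe, norm_coe, mul_one, mul_one] at h1

/-! ### Cutting off a cap -/

theorem isConvexBody_inter_halfspace {C : Set S2} (hC : IsConvexBody C) {q : E3} {x : S2}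
    (hx : x ∈ interior C) (hqx : 0 < inner ℝ q (x : E3)) :
    IsConvexBody {y ∈ C | 0 ≤ inner ℝ q (y : E3)} where
  isClosed := by
    have h : IsClosed {y : S2 | 0 ≤ inner ℝ q (y : E3)} :=
      isClosed_le continuous_const (continuous_const.inner continuous_subtype_val)
    exact hC.isClosed.inter h
  convex := by
    refine ⟨fun a ha hna => hC.convex.1 a ha.1 hna.1, fun a ha b hb y hy => ?_⟩
    refine ⟨hC.convex.2 a ha.1 b hb.1 hy, ?_⟩
    obtain ⟨s, t, hs, ht, e⟩ := hy
    rw [e, inner_add_right, inner_smul_right, inner_smul_right]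
    exact add_nonneg (mul_nonneg hs ha.2) (mul_nonneg ht hb.2)
  nonempty_interior := by
    refine ⟨x, mem_interior.2 ⟨interior C ∩ {y | 0 < inner ℝ q (y : E3)},
      fun y hy => ⟨interior_subset hy.1, le_of_lt hy.2⟩, ?_, hx, hqx⟩⟩
    exact isOpen_interior.inter (isOpen_lt continuous_const
      (continuous_const.inner continuous_subtype_val))

/-- If `u` is within the angle `arccos c₀` of `k`, and `c < c₀`, then it is within the angle
`arccos c` of `k - εp` for small `ε`, with a bound for `ε` that does not depend on `u`. -/
theorem mem_capCone_sub_smul {k p : S2} {u : E3} {c c₀ ε : ℝ} (hc : 0 ≤ c) (hc1 : c ≤ 1)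
    (hc₀ : 0 ≤ c₀) (hε : 0 ≤ ε) (hεc : 2 * ε ≤ c₀ - c) (hu : u ∈ capCone c₀ hc₀ (k : E3)) :
    u ∈ capCone c hc ((k : E3) - ε • (p : E3)) := by
  rw [mem_capCone, norm_coe, mul_one] at hu
  have h1 : ‖(k : E3) - ε • (p : E3)‖ ≤ 1 + ε := by
    refine (norm_sub_le _ _).trans ?_
    rw [norm_smul, norm_coe, norm_coe, Real.norm_of_nonneg hε, mul_one]
  have h2 := real_inner_le_norm u (p : E3)
  rw [norm_coe, mul_one] at h2
  rw [mem_capCone, inner_sub_right, inner_smul_right]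
  have h3 : c * ‖u‖ * ‖(k : E3) - ε • (p : E3)‖ ≤ c * ‖u‖ * (1 + ε) :=
    mul_le_mul_of_nonneg_left h1 (by positivity)
  have h4 : ε * inner ℝ u (p : E3) ≤ ε * ‖u‖ := mul_le_mul_of_nonneg_left h2 hε
  have h5 : c * (ε * ‖u‖) ≤ 1 * (ε * ‖u‖) := mul_le_mul_of_nonneg_right hc1 (by positivity)
  have h6 : 2 * ε * ‖u‖ ≤ (c₀ - c) * ‖u‖ := mul_le_mul_of_nonneg_right hεc (norm_nonneg u)
  linarith

theorem width_le_thickness_of_isReduced {R : Set S2} (hR : IsReduced R)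
    (hΔ : Real.pi / 2 ≤ thickness R) {k : S2} (hk : Supports k R) :
    width R k ≤ thickness R := by
  by_contra! hlt
  have hRb := hR.1
  have hpi := Real.pi_pos
  set w := thickness R with hwdef
  have hw0 : 0 ≤ w := by linarith
  have hwpi : w ≤ Real.pi := hlt.le.trans (width_le_pi R k)
  have hc : 0 ≤ -Real.cos w :=
    neg_nonneg.2 (Real.cos_nonpos_of_pi_div_two_le_of_le hΔ (by linarith))
  have hcc₀ : -Real.cos w < -Real.cos (width R k) :=
    neg_lt_neg (Real.cos_lt_cos_of_nonneg_of_le_pi hw0 (width_le_pi R k) hlt)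
  have hc1 : -Real.cos w ≤ 1 := by linarith [Real.neg_one_le_cos w]
  have hkR := hk.mem_polar
  have hcap : ∀ u ∈ polar R, u ∈ capCone (-Real.cos (width R k)) (hc.trans hcc₀.le) (k : E3) :=
    fun u hu => inner_ge_of_lune_bound hRb hkR _ (by linarith [Real.neg_one_le_cos (width R k)])
      (fun m hm hl => neg_cos_le_inner (width_nonneg R k) (width_le hm hl)) hu
  have hpair : ∀ u ∈ polar R, ∀ v ∈ polar R, u ∈ capCone (-Real.cos w) hc v :=
    fun u hu v hv => mem_capCone_of_le_thickness hRb ⟨k, hk⟩ hw0 le_rfl hc hu hv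
  obtain ⟨p, hpf, -, hpk⟩ := hk
  have hpR : p ∈ R := hRb.isClosed.frontier_subset hpf
  have hpk0 := (greatCircle_iff k p).1 hpk
  obtain ⟨x, hx⟩ := hRb.nonempty_interior
  have hxk := inner_pos_of_mem_interior hkR (ne_zero_of_mem_unit_sphere k) hx
  -- `ε` is small enough for `mem_capCone_sub_smul` and for keeping `x` in the smaller body.
  obtain ⟨ε, hε, hεm⟩ := exists_between (lt_min (half_pos (sub_pos.2 hcc₀)) hxk)
  obtain ⟨hεc, hεx⟩ := lt_min_iff.1 hεm
  set q : E3 := (k : E3) - ε • (p : E3) with hq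
  have hqx : 0 < inner ℝ q (x : E3) := by
    have h := real_inner_le_norm (p : E3) (x : E3)
    rw [norm_coe, norm_coe, mul_one] at h
    rw [hq, inner_sub_left, real_inner_smul_left, real_inner_comm]
    nlinarith
  have hqp : inner ℝ q (p : E3) < 0 := by
    rw [hq, inner_sub_left, real_inner_smul_left, real_inner_comm, hpk0, inner_coe_self]
    linarith
  have hqcap : ∀ u ∈ polar R, u ∈ capCone (-Real.cos w) hc q := fun u hu =>
    mem_capCone_sub_smul hc hc1 _ hε.le (by linarith) (hcap u hu)
  set Z : Set S2 := {y ∈ R | 0 ≤ inner ℝ q (y : E3)} with hZ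
  have hZb : IsConvexBody Z := isConvexBody_inter_halfspace hRb hx hqx
  have hZq : ∀ u ∈ polar Z, u ∈ capCone (-Real.cos w) hc q := fun u hu =>
    polar_inter_halfspace_le hRb hqcap (self_mem_capCone hc1 q) hu
  have hZR : ∀ u ∈ polar Z, ∀ v ∈ polar R, u ∈ capCone (-Real.cos w) hc v := fun u hu v hv =>
    polar_inter_halfspace_le hRb (fun u hu => hpair u hu v hv)
      (mem_capCone_comm.1 (hqcap v hv)) hu
  have hZZ : ∀ u ∈ polar Z, ∀ v ∈ polar Z, u ∈ capCone (-Real.cos w) hc v := fun u hu v hv =>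
    polar_inter_halfspace_le hRb (fun u hu => mem_capCone_comm.1 (hZR v hv u hu))
      (mem_capCone_comm.1 (hZq v hv)) hu
  have hkZ : (k : E3) ∈ polar Z := mem_polar.2 fun y hy => mem_polar.1 hkR y hy.1
  have hqZ : q ∈ polar Z := mem_polar.2 fun y hy => by
    rw [real_inner_comm]
    exact hy.2
  have hli : LinearIndependent ℝ ![(k : E3), q] := by
    rw [LinearIndependent.pair_iff]
    intro s t hst
    have h1 := congrArg (fun v => inner ℝ (p : E3) v) hst
    simp only [hq, inner_add_right, inner_smul_right, inner_sub_right, hpk0, inner_coe_self,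
      inner_zero_right] at h1
    have ht : t = 0 := by
      have h2 : t * ε = 0 := by linarith
      exact (mul_eq_zero.1 h2).resolve_right hε.ne'
    refine ⟨?_, ht⟩
    rw [ht, zero_smul, add_zero] at hst
    exact (smul_eq_zero.1 hst).resolve_right (ne_zero_of_mem_unit_sphere k)
  have hthick : w ≤ thickness Z := le_thickness_of_mem_capCone hZb hw0 hwpi hZZ hkZ hqZ hli
  refine (hR.2 Z hZb (fun y hy => hy.1) fun e => ?_).not_ge hthick
  have hpZ : p ∈ Z := by rw [e]; exact hpR
  exact hqp.not_ge hpZ.2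

end S2

theorem theorem4 (R : Set S2) (hR : S2.IsReduced R) (hΔ : Real.pi / 2 ≤ S2.thickness R) :
    S2.IsConstantWidth R (S2.thickness R) :=
  ⟨hR.1, fun _ hk =>
    le_antisymm (S2.width_le_thickness_of_isReduced hR hΔ hk) (S2.thickness_le_width hk)⟩
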